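/- Let $X$ be a locally compact Polish space, let $\mathcal B_c(X)$ be the family of Borel subsets of $X$ with compact closure, and let $\mathbb K(X)$ be the cone of non-negative discrete Radon measures on $X$, i.e. Radon measures of the form $\eta=\sum_i s_i\delta_{x_i}$ with at most countably many distinct atoms $x_i\in X$ and weights $s_i>0$ (including $\eta=0$), equipped with the Borel $\sigma$-algebra of the vague topology. Put $\mathbb R_+^*=(0,\infty)$ and $\hat X=\mathbb R_+^*\times X$, and let $\Gamma(\hat X)$ be the space of all $\gamma\subset\hat X$ such that $\gamma\cap([a,b]\times\Lambda)$ is finite for all $0<a<b$ and $\Lambda\in\mathcal B_c(X)$, equipped with the Borel $\sigma$-algebra of the vague topology (identify $\gamma$ with $\sum_{y\in\gamma}\delta_y$). Let $\Pi(\hat X)\subset\Gamma(\hat X)$ be the set of those $\gamma$ which contain at most one point $(s,x)$ for each $x\in X$ and satisfy $\sum_{(s,x)\in\gamma}s\,\mathbf 1_\Lambda(x)<\infty$ for all $\Lambda\in\mathcal B_c(X)$, and let $\mathcal R:\Pi(\hat X)\to\mathbb K(X)$, $\mathcal R(\gamma)=\sum_{(s,x)\in\gamma}s\,\delta_x$.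 Let $\nu$ and $\sigma$ be non-atomic positive Radon measures on $\mathbb R_+^*$ and $X$, respectively, with $\int_{\mathbb R_+^*}s\,d\nu(s)<\infty$. Let $\pi_{\nu\otimes\sigma}$ be the Poisson measure on $\Gamma(\hat X)$ with intensity measure $\nu\otimes\sigma$, that is, the number of points in each relatively compact Borel set $B\subset\hat X$ is Poisson distributed with mean $(\nu\otimes\sigma)(B)$, and the numbers of points in finitely many pairwise disjoint such sets are independent. This measure is carried by $\Pi(\hat X)$; let $\pi_{\mathbb K,\nu\otimes\sigma}$ be the image under $\mathcal R$ of $\pi_{\nu\otimes\sigma}$ regarded as a measure on $\Pi(\hat X)$. A measure $\mu$ on $\mathbb K(X)$ is said to belong to $\mathcal M^1_{\mathrm{fm}}(\mathbb K(X))$ (finite local moments of all orders) if it is a probability measure and $\int_{\mathbb K(X)}\eta(\Lambda)^n\,d\mu(\eta)<\infty$ for all integers $n\ge1$ and all $\Lambda\in\mathcal B_c(X)$. If $\sigma\neq0$, then $\pi_{\mathbb K,\nu\otimes\sigma}\in\mathcal M^1_{\mathrm{fm}}(\mathbb K(X))$ if and only if $\int_{\mathbb R_+^*}s^n\,d\nu(s)<\infty$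 for all integers $n\ge1$. In particular, for every non-atomic positive Radon measure $\sigma$ on $X$ and every $\theta>0$, the Gamma measure $\mathcal G_\theta=\pi_{\mathbb K,\nu_\theta\otimes\sigma}$, where $\nu_\theta(ds)=\frac{\theta}{s}e^{-s}\,ds$, belongs to $\mathcal M^1_{\mathrm{fm}}(\mathbb K(X))$. -/

import Mathlib

open MeasureTheory Set

namespace Cone

/-- The half-line `(0, ∞)` of weights. Its subspace topology is that of the metric
`|log s₁ - log s₂|`. -/
abbrev PosReal : Type := Set.Ioi (0 : ℝ)

/-- Borel sets with compact closure. -/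
def BorelCompact (Y : Type*) [TopologicalSpace Y] [MeasurableSpace Y] : Set (Set Y) :=
  {B | MeasurableSet B ∧ IsCompact (closure B)}

/-- The vague topology on a set `T` of (non-negative) Radon measures on `Y`: the coarsest topology
for which `t ↦ ∫ f dt` is continuous for every continuous compactly supported `f : Y → ℝ`. -/
noncomputable abbrev vagueTopology {Y T : Type*} [TopologicalSpace Y] [MeasurableSpace Y]
    (toMeasure : T → Measure Y) : TopologicalSpace T :=
  ⨅ f : CompactlySupportedContinuousMap Y ℝ,
    TopologicalSpace.induced (fun t => ∫ y, f y ∂(toMeasure t)) inferInstance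

section Cone

variable (X : Type*) [TopologicalSpace X] [MeasurableSpace X]

/-- The cone of non-negative discrete Radon measures `∑ᵢ sᵢ δ_{xᵢ}` on `X`: at most countably many
atoms, all distinct, with weights in `(0, ∞)`. -/
structure DiscreteMeasure where
  toMeasure : Measure X
  radon : ∀ C : Set X, IsCompact C → toMeasure C < ⊤
  discrete : ∃ (A : Set X) (s : X → ℝ), A.Countable ∧ (∀ x ∈ A, 0 < s x) ∧
    toMeasure = Measure.sum (fun x : A => ENNReal.ofReal (s x) • Measure.dirac (x : X))

noncomputable instance : TopologicalSpace (DiscreteMeasure X) :=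
  vagueTopology DiscreteMeasure.toMeasure

noncomputable instance : MeasurableSpace (DiscreteMeasure X) := borel _

instance : BorelSpace (DiscreteMeasure X) := ⟨rfl⟩

/-- Locally finite configurations in `(0, ∞) × X`. -/
structure Configuration where
  carrier : Set (PosReal × X)
  locallyFinite : ∀ Λ ∈ BorelCompact X, ∀ a b : ℝ, 0 < a → a < b →
    (carrier ∩ {p | (p.1 : ℝ) ∈ Set.Icc a b ∧ p.2 ∈ Λ}).Finite

variable {X}

/-- The Radon measure `∑_{y ∈ γ} δ_y` identified with the configuration `γ`. -/
noncomputable def Configuration.toMeasure (γ : Configuration X) : Measure (PosReal × X) :=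
  Measure.sum (fun p : γ.carrier => Measure.dirac (p : PosReal × X))

noncomputable instance : TopologicalSpace (Configuration X) :=
  vagueTopology Configuration.toMeasure

noncomputable instance : MeasurableSpace (Configuration X) := borel _

instance : BorelSpace (Configuration X) := ⟨rfl⟩

/-- `π` is the Poisson measure with intensity measure `m` on the configuration space: the number of
points in a relatively compact Borel set `B` is Poisson distributed with mean `m B`, and the numbers
of points in finitely many pairwise disjoint such sets are independent. -/
structure IsPoissonMeasure (m : Measure (PosReal × X)) (π : Measure (Configuration X)) : Prop where
  count_law : ∀ B ∈ BorelCompact (PosReal × X),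
    π.map (fun γ => (γ.carrier ∩ B).ncard) = ProbabilityTheory.poissonMeasure (m B).toNNReal
  count_indep : ∀ (k : ℕ) (B : Fin k → Set (PosReal × X)),
    (∀ i, B i ∈ BorelCompact (PosReal × X)) → Pairwise (fun i j => Disjoint (B i) (B j)) →
    ProbabilityTheory.iIndepFun (fun i (γ : Configuration X) => (γ.carrier ∩ B i).ncard) π

/-- The local mass `γ(Λ) = ∑_{(s,x) ∈ γ} s 1_Λ(x) ∈ [0, ∞]`. -/
noncomputable def Configuration.localMass (γ : Configuration X) (Λ : Set X) : ENNReal :=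
  ∫⁻ p, ENNReal.ofReal (p.1 : ℝ) * Λ.indicator 1 p.2 ∂γ.toMeasure

variable (X) in
/-- Pinpointing configurations (each location `x` carries at most one weight) with finite local
mass. -/
def PinpointingFinite : Set (Configuration X) :=
  {γ | (∀ p ∈ γ.carrier, ∀ q ∈ γ.carrier, p.2 = q.2 → p.1 = q.1) ∧
    ∀ Λ ∈ BorelCompact X, γ.localMass Λ < ⊤}

theorem Configuration.countable [LocallyCompactSpace X] [PolishSpace X] [BorelSpace X]
    (γ : Configuration X) : γ.carrier.Countable := by
  have h : γ.carrier ⊆ ⋃ n : ℕ, (γ.carrier ∩ {p | (p.1 : ℝ) ∈ Set.Icc (1 / ((n : ℝ) + 1)) (n + 2) ∧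
      p.2 ∈ compactCovering X n}) := by
    intro p hp
    obtain ⟨n₁, h₁⟩ := exists_nat_one_div_lt (Set.mem_Ioi.1 p.1.2)
    obtain ⟨n₂, h₂⟩ := exists_nat_ge (p.1 : ℝ)
    obtain ⟨n₃, h₃⟩ := exists_mem_compactCovering p.2
    refine Set.mem_iUnion.2 ⟨max n₁ (max n₂ n₃), hp, ⟨?_, ?_⟩, ?_⟩
    · refine le_trans ?_ h₁.le
      have : (n₁ : ℝ) ≤ (max n₁ (max n₂ n₃) : ℕ) := by exact_mod_cast le_max_left _ _
      gcongr
    · have : (n₂ : ℝ) ≤ (max n₁ (max n₂ n₃) : ℕ) := by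
        exact_mod_cast (le_max_left _ _).trans (le_max_right _ _)
      linarith
    · exact compactCovering_subset X ((le_max_right _ _).trans (le_max_right _ _)) h₃
  refine (Set.countable_iUnion fun n => (γ.locallyFinite _ ?_ _ _ ?_ ?_).countable).mono h
  · have hc := isCompact_compactCovering X n
    exact ⟨hc.isClosed.measurableSet, hc.isClosed.closure_eq.symm ▸ hc⟩
  · positivity
  · have : 1 / ((n : ℝ) + 1) ≤ 1 := by
      rw [div_le_one (by positivity)]
      linarith [Nat.cast_nonneg (α := ℝ) n]
    linarith [Nat.cast_nonneg (α := ℝ) n]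

theorem Configuration.localMass_eq (γ : Configuration X) {Λ : Set X} (hΛ : MeasurableSet Λ) :
    γ.localMass Λ = Measure.sum (fun p : γ.carrier =>
      ENNReal.ofReal (p.1.1 : ℝ) • Measure.dirac p.1.2) Λ := by
  rw [Configuration.localMass, Configuration.toMeasure, lintegral_sum_measure,
    Measure.sum_apply _ hΛ]
  refine tsum_congr fun p => ?_
  have hm : Measurable fun p : PosReal × X =>
      ENNReal.ofReal (p.1 : ℝ) * Λ.indicator (1 : X → ENNReal) p.2 :=
    (measurable_subtype_coe.comp measurable_fst).ennreal_ofReal.mul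
      ((measurable_one.indicator hΛ).comp measurable_snd)
  rw [lintegral_dirac' _ hm, Measure.smul_apply, Measure.dirac_apply' _ hΛ, smul_eq_mul]

/-- The map `∑_{(s,x) ∈ γ} δ_{(s,x)} ↦ ∑_{(s,x) ∈ γ} s δ_x` from pinpointing configurations with
finite local mass to the cone. -/
noncomputable def toCone [LocallyCompactSpace X] [PolishSpace X] [BorelSpace X]
    (γ : PinpointingFinite X) : DiscreteMeasure X where
  toMeasure := Measure.sum (fun p : γ.1.carrier =>
    ENNReal.ofReal (p.1.1 : ℝ) • Measure.dirac p.1.2)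
  radon C hC := by
    rw [← γ.1.localMass_eq hC.isClosed.measurableSet]
    exact γ.2.2 C ⟨hC.isClosed.measurableSet, hC.isClosed.closure_eq.symm ▸ hC⟩
  discrete := by
    classical
    have hinj : Function.Injective (fun p : γ.1.carrier => p.1.2) := by
      intro p q h
      exact Subtype.ext (Prod.ext (γ.2.1 _ p.2 _ q.2 h) h)
    let e := Equiv.ofInjective _ hinj
    let s : X → ℝ := fun x => if h : x ∈ Set.range (fun p : γ.1.carrier => p.1.2) then
      ((e.symm ⟨x, h⟩).1.1 : ℝ) else 1
    have hs : ∀ p : γ.1.carrier, s p.1.2 = (p.1.1 : ℝ) := by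
      intro p
      have h : p.1.2 ∈ Set.range (fun p : γ.1.carrier => p.1.2) := ⟨p, rfl⟩
      have h' : e.symm ⟨p.1.2, h⟩ = p := e.symm_apply_eq.2 rfl
      simp only [s, dif_pos h, h']
    have := γ.1.countable.to_subtype
    refine ⟨Set.range (fun p : γ.1.carrier => p.1.2), s, Set.countable_range _, ?_, ?_⟩
    · rintro _ ⟨p, rfl⟩
      rw [hs p]
      exact p.1.1.2
    · ext B hB
      rw [Measure.sum_apply _ hB, Measure.sum_apply _ hB]
      rw [← e.tsum_eq]
      refine tsum_congr fun p => ?_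
      have : ((e p : Set.range (fun p : γ.1.carrier => p.1.2)) : X) = p.1.2 := rfl
      rw [this, hs p]

/-- The image on the cone of a measure on configurations: restrict `π` to the trace `σ`-algebra of
`PinpointingFinite X`, then push forward under `toCone`. -/
noncomputable def coneLaw [LocallyCompactSpace X] [PolishSpace X] [BorelSpace X]
    (π : Measure (Configuration X)) : Measure (DiscreteMeasure X) :=
  (π.comap ((↑) : PinpointingFinite X → Configuration X)).map toCone

/-- `μ` is the law on the cone obtained from the Poisson measure with intensity `ν ⊗ σ`. -/
def IsConePoisson [LocallyCompactSpace X] [PolishSpace X] [BorelSpace X]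
    (ν : Measure PosReal) (σ : Measure X) (μ : Measure (DiscreteMeasure X)) : Prop :=
  ∃ π : Measure (Configuration X), IsPoissonMeasure (ν.prod σ) π ∧ μ = coneLaw π

/-- `μ` is a probability measure on the cone with finite local moments of all orders. -/
def HasFiniteLocalMoments (μ : Measure (DiscreteMeasure X)) : Prop :=
  IsProbabilityMeasure μ ∧ ∀ n : ℕ, 1 ≤ n → ∀ Λ ∈ BorelCompact X,
    ∫⁻ η, (η.toMeasure Λ) ^ n ∂μ < ⊤

end Cone

/-- `ν` has finite moments of all orders `n ≥ 1`. -/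
def HasFiniteMoments (ν : Measure PosReal) : Prop :=
  ∀ n : ℕ, 1 ≤ n → ∫⁻ s, ENNReal.ofReal ((s : ℝ) ^ n) ∂ν < ⊤

/-- The measure `(θ / s) e^{-s} ds` on `(0, ∞)`. -/
noncomputable def gammaIntensity (θ : ℝ) : Measure PosReal :=
  ((volume : Measure ℝ).comap ((↑) : PosReal → ℝ)).withDensity
    (fun s => ENNReal.ofReal (θ / (s : ℝ) * Real.exp (-(s : ℝ))))

end Cone

/-! Under `toCone` the mass of `Λ` becomes the sum `S` of the weights of the Poisson points located
in `Λ`, so the claim concerns the moments of `S`.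

Necessity: `∑ sᵢ ^ n ≤ (∑ sᵢ) ^ n` for nonnegative weights, and Campbell's formula turns the mean of
the left side into `σ Λ * ∫ s ^ n dν`. A compact `Λ` of positive `σ`-measure then bounds the moments
of `ν` (`lintegral_pow_le_localMass_pow`).

Sufficiency: rounding weights up to powers of two gives `S ≤ ∑ aₖ Nₖ` with `aₖ = 2 ^ (k + 1)` and
independent Poisson counts `Nₖ` of means `rₖ` (`localMass_le_tsum_dyadic`). The Stein–Chen identity
yields a recursion bounding the moment of order `n + 1` of such a sum by that of order `n` and the
quantities `∑ aₖ rₖ`, `∑ aₖ ^ (n + 1) rₖ` (`lintegral_sum_pow_succ_le`). These are controlled by the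
moments of `ν`, and induction on `n` concludes.

Passing to the cone requires that the Poisson measure be carried by `PinpointingFinite X`
(`ae_mem_pinpointingFinite`) and that `toCone` be Borel for the vague topologies
(`measurable_toCone`). For the Gamma measure the moments of `ν` are `θ Γ(n)`. -/

namespace Cone

/-! ### Measurability and the vague topology. -/

section Vague

open Filter Topology

variable {Y : Type*} [TopologicalSpace Y] [PolishSpace Y] [LocallyCompactSpace Y]
  [MeasurableSpace Y] [BorelSpace Y]

omit [PolishSpace Y] [LocallyCompactSpace Y] in
theorem integrable_of_compactSupport (m : Measure Y) [IsFiniteMeasureOnCompacts m]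
    (f : CompactlySupportedContinuousMap Y ℝ) : Integrable f m :=
  f.continuous.integrable_of_hasCompactSupport f.hasCompactSupport

/-- A family of Radon measures depends measurably on its parameter as soon as the integrals of
compactly supported continuous functions do. -/
theorem measurable_of_measurable_integral {T : Type*} [MeasurableSpace T] {κ : T → Measure Y}
    [∀ t, IsFiniteMeasureOnCompacts (κ t)]
    (h : ∀ f : CompactlySupportedContinuousMap Y ℝ, Measurable fun t => ∫ y, f y ∂κ t) :
    Measurable κ := by
  have hK : ∀ K : Set Y, IsCompact K → Measurable fun t => κ t K := by
    intro K hK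
    let := TopologicalSpace.upgradeIsCompletelyMetrizable Y
    obtain ⟨f, hf, -, hfc, hf01⟩ := exists_continuous_one_zero_of_isCompact_of_isGδ hK
      hK.isClosed.isGδ isClosed_empty (disjoint_empty K)
    -- As `f` equals `1` exactly on `K`, its powers decrease to the indicator of `K`. The exponent
    -- `n + 1` avoids `f ^ 0 = 1`, which need not have compact support.
    have hint : ∀ n : ℕ, Measurable fun t => ∫ y, f y ^ (n + 1) ∂κ t := fun n =>
      h ⟨⟨fun y => f y ^ (n + 1), by fun_prop⟩, by
        refine hfc.mono fun y hy => ?_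
        contrapose! hy
        simp only [Function.mem_support, not_not] at hy ⊢
        simp [hy]⟩
    have hlim : ∀ t, Tendsto (fun n : ℕ => ∫ y, f y ^ (n + 1) ∂κ t) atTop
        (𝓝 ((κ t).real K)) := by
      intro t
      rw [← integral_indicator_one hK.isClosed.measurableSet]
      refine tendsto_integral_of_dominated_convergence f
        (fun n => (f.continuous.pow _).aestronglyMeasurable)
        (f.continuous.integrable_of_hasCompactSupport hfc) ?_ ?_
      · refine fun n => .of_forall fun y => ?_
        rw [Real.norm_of_nonneg (pow_nonneg (hf01 y).1 _), pow_succ]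
        exact mul_le_of_le_one_left (hf01 y).1 (pow_le_one₀ (hf01 y).1 (hf01 y).2)
      · refine .of_forall fun y => ?_
        by_cases hy : y ∈ K
        · have h1 : f y = 1 := by
            rw [hf] at hy
            exact hy
          simp [h1, hy]
        · have h1 : f y ≠ 1 := fun h1 => hy (by rw [hf]; exact h1)
          rw [indicator_of_notMem hy]
          exact (tendsto_pow_atTop_nhds_zero_of_lt_one (hf01 y).1
            (lt_of_le_of_ne (hf01 y).2 h1)).comp (tendsto_add_atTop_nat 1)
    have hr : Measurable fun t => (κ t).real K :=
      measurable_of_tendsto_metrizable hint (tendsto_pi_nhds.2 hlim)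
    have heq : (fun t => κ t K) = fun t => ENNReal.ofReal ((κ t).real K) := by
      ext t
      exact (ofReal_measureReal hK.measure_lt_top.ne).symm
    rw [heq]
    exact hr.ennreal_ofReal
  have hres : ∀ n, Measurable fun t => (κ t).restrict (compactCovering Y n) := by
    intro n
    have hc := isCompact_compactCovering Y n
    have : ∀ t, IsFiniteMeasure ((κ t).restrict (compactCovering Y n)) := fun t =>
      ⟨by simpa using hc.measure_lt_top⟩
    refine Measurable.measure_of_isPiSystem
      ((BorelSpace.measurable_eq (α := Y)).trans borel_eq_generateFrom_isClosed)
      isPiSystem_isClosed ?_ ?_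
    · intro F hF
      simp only [Measure.restrict_apply (IsClosed.measurableSet hF)]
      exact hK _ (hc.inter_left hF)
    · simpa using hK _ hc
  refine Measure.measurable_of_measurable_coe _ fun B hB => ?_
  have heq : (fun t => κ t B) = fun t => ⨆ n, (κ t).restrict (compactCovering Y n) B := by
    ext t
    simp only [Measure.restrict_apply hB]
    rw [← (Monotone.measure_iUnion (μ := κ t) (s := fun n => B ∩ compactCovering Y n)
      fun i j hij => inter_subset_inter_right _ (compactCovering_subset Y hij)), ← inter_iUnion,
      iUnion_compactCovering, inter_univ]
  rw [heq]
  exact .iSup fun n => (Measure.measurable_coe hB).comp (hres n)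

/-- The function `h` is chosen before `ε`, so an error `ε * h` integrates to at most `ε ∫ h dκ`,
uniformly over measures for which `∫ h dκ` is bounded. Countability comes from separability of `C(Y,
ℝ)` in the compact-open topology, applied to functions supported in each member of a compact
exhaustion. -/
theorem exists_countable_dense_compactSupport (Y : Type*) [TopologicalSpace Y] [PolishSpace Y]
    [LocallyCompactSpace Y] :
    ∃ D : Set (CompactlySupportedContinuousMap Y ℝ), D.Countable ∧
      ∀ f : CompactlySupportedContinuousMap Y ℝ, ∃ h ∈ D, (∀ y, 0 ≤ h y) ∧ ∀ ε > 0, ∃ g ∈ D,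
        ∀ y, |f y - g y| ≤ ε * h y := by
  let := TopologicalSpace.upgradeIsCompletelyMetrizable Y
  let K := CompactExhaustion.choice Y
  have hbump : ∀ n : ℕ, ∃ h : CompactlySupportedContinuousMap Y ℝ,
      EqOn h 1 (K n) ∧ ∀ y, h y ∈ Icc (0 : ℝ) 1 := by
    intro n
    obtain ⟨f, hf, -, hfc, hf01⟩ := exists_continuous_one_zero_of_isCompact
      (K.isCompact n) isClosed_empty (disjoint_empty _)
    exact ⟨⟨f, hfc⟩, hf, hf01⟩
  choose h hh1 hh01 using hbump
  let S : ℕ → Set C(Y, ℝ) := fun n => {f | tsupport f ⊆ K n}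
  have hdense : ∀ n, ∃ t : Set C(Y, ℝ), t ⊆ S n ∧ t.Countable ∧ S n ⊆ closure t := fun n =>
    TopologicalSpace.IsSeparable.exists_countable_dense_subset
      (TopologicalSpace.IsSeparable.of_separableSpace (S n))
  choose t hts htc htd using hdense
  have hcs : ∀ n (f : t n), HasCompactSupport (f : C(Y, ℝ)) := fun n f =>
    (K.isCompact n).of_isClosed_subset (isClosed_tsupport _) (hts n f.2)
  refine ⟨range h ∪ ⋃ n, range fun f : t n => ⟨f.1, hcs n f⟩, ?_, ?_⟩
  · refine (countable_range h).union (countable_iUnion fun n => ?_)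
    have := (htc n).to_subtype
    exact countable_range _
  · intro f
    obtain ⟨n, hn⟩ := K.exists_superset_of_isCompact f.hasCompactSupport
    refine ⟨h n, .inl ⟨n, rfl⟩, fun y => (hh01 n y).1, fun ε hε => ?_⟩
    have hfS : (f : C(Y, ℝ)) ∈ closure (t n) := htd n hn
    have hnhds : {g : C(Y, ℝ) | ∀ y ∈ K n, dist (f y) (g y) < ε} ∈
        𝓝 (f : C(Y, ℝ)) := by
      have := ContinuousMap.tendsto_iff_forall_isCompact_tendstoUniformlyOn.1
        (tendsto_id (α := C(Y, ℝ)) (x := 𝓝 (f : C(Y, ℝ)))) _ (K.isCompact n)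
      exact Metric.tendstoUniformlyOn_iff.1 this ε hε
    obtain ⟨g, hg, hgt⟩ := mem_closure_iff_nhds.1 hfS _ hnhds
    refine ⟨⟨g, hcs n ⟨g, hgt⟩⟩, .inr (mem_iUnion.2 ⟨n, ⟨g, hgt⟩, rfl⟩), fun y => ?_⟩
    by_cases hy : y ∈ K n
    · rw [hh1 n hy, Pi.one_apply, mul_one]
      exact (hg y hy).le
    · have h1 : f y = 0 := image_eq_zero_of_notMem_tsupport fun h => hy (hn h)
      have h2 : g y = 0 := image_eq_zero_of_notMem_tsupport fun h => hy (hts n hgt h)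
      change |f y - g y| ≤ _
      rw [h1, h2]
      simpa using mul_nonneg hε.le (hh01 n y).1

/-- The vague topology is generated by countably many of the functions `t ↦ ∫ f dt`. -/
theorem exists_countable_vagueTopology_eq {T : Type*} (κ : T → Measure Y)
    [∀ t, IsFiniteMeasureOnCompacts (κ t)] :
    ∃ D : Set (CompactlySupportedContinuousMap Y ℝ), D.Countable ∧
      vagueTopology κ = ⨅ f : D,
        TopologicalSpace.induced (fun t => ∫ y, f.1 y ∂κ t) inferInstance := by
  obtain ⟨D, hD, hDd⟩ := exists_countable_dense_compactSupport Y
  refine ⟨D, hD, le_antisymm (le_iInf fun f => iInf_le _ f.1) (le_iInf fun f => ?_)⟩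
  let τ : TopologicalSpace T := ⨅ f : D,
    TopologicalSpace.induced (fun t => ∫ y, f.1 y ∂κ t) inferInstance
  have hcont : ∀ g ∈ D, Continuous fun t => ∫ y, g y ∂κ t := fun g hg =>
    continuous_iff_le_induced.2 (iInf_le _ (⟨g, hg⟩ : D))
  obtain ⟨h, hh, h0, happ⟩ := hDd f
  refine continuous_iff_le_induced.1 (continuous_iff_continuousAt.2 fun t₀ => ?_)
  refine continuousAt_of_locally_uniform_approx_of_continuousAt fun u hu => ?_
  obtain ⟨ε, hε, hεu⟩ := Metric.mem_uniformity_dist.1 hu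
  set M := ∫ y, h y ∂κ t₀ with hM
  have hM0 : 0 ≤ M := integral_nonneg h0
  obtain ⟨g, hg, hfg⟩ := happ (ε / (2 * (M + 1))) (by positivity)
  -- Since `h ∈ D`, this set is open for the topology generated by `D`. On it `∫ f` and `∫ g` differ
  -- by at most `ε / 2`.
  refine ⟨{t | ∫ y, h y ∂κ t < M + 1}, ?_, fun t => ∫ y, g y ∂κ t, (hcont g hg).continuousAt, ?_⟩
  · exact (isOpen_lt (hcont h hh) continuous_const).mem_nhds (lt_add_one M)
  · intro t ht
    refine hεu ?_
    have hi := integrable_of_compactSupport (κ t)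
    rw [Real.dist_eq, ← integral_sub (hi f) (hi g)]
    calc |∫ y, (f y - g y) ∂κ t| ≤ ∫ y, |f y - g y| ∂κ t := abs_integral_le_integral_abs
      _ ≤ ∫ y, ε / (2 * (M + 1)) * h y ∂κ t :=
        integral_mono ((hi f).sub (hi g)).abs ((hi h).const_mul _) hfg
      _ = ε / (2 * (M + 1)) * ∫ y, h y ∂κ t := integral_const_mul _ _
      _ ≤ ε / (2 * (M + 1)) * (M + 1) := by
        gcongr
        exact ht.le
      _ < ε := by
        field_simp
        linarith

/-- Into the Borel space of a vague topology, a map is measurable as soon as the measures it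
parametrizes depend measurably on the argument. -/
theorem measurable_into_vague {T Ω : Type*} (κ : T → Measure Y)
    [∀ t, IsFiniteMeasureOnCompacts (κ t)] [MeasurableSpace Ω] {g : Ω → T}
    (hg : Measurable fun ω => κ (g ω)) :
    @Measurable Ω T _ (@borel T (vagueTopology κ)) g := by
  obtain ⟨D, hD, hτ⟩ := exists_countable_vagueTopology_eq κ
  have := hD.to_subtype
  let : TopologicalSpace T := vagueTopology κ
  -- Second countability makes the Borel σ-algebra of the topology equal to the one generated by a
  -- subbasis, so testing one `f` at a time suffices.
  have : SecondCountableTopology T := by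
    change @SecondCountableTopology T (vagueTopology κ)
    rw [hτ]
    exact TopologicalSpace.secondCountableTopology_iInf fun f =>
      TopologicalSpace.secondCountableTopology_induced _ _ _
  have hgen : vagueTopology κ = .generateFrom
      (⋃ f : CompactlySupportedContinuousMap Y ℝ,
        {s | ∃ U, IsOpen U ∧ (fun t => ∫ y, f y ∂κ t) ⁻¹' U = s}) := by
    rw [vagueTopology, generateFrom_iUnion]
    congr 1
    ext1 f
    exact (@TopologicalSpace.generateFrom_setOfPred_isOpen _ (TopologicalSpace.induced _ _)).symm
  rw [borel_eq_generateFrom_of_subbasis hgen]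
  refine measurable_generateFrom fun s hs => ?_
  obtain ⟨f, U, hU, rfl⟩ := mem_iUnion.1 hs
  have hm : Measurable fun ω => ∫ y, f y ∂κ (g ω) := by
    let k : ProbabilityTheory.Kernel Ω Y := ⟨fun ω => κ (g ω), hg⟩
    exact (StronglyMeasurable.integral_kernel (κ := k)
      f.continuous.stronglyMeasurable).measurable
  exact hm hU.measurableSet

end Vague

/-! ### Identities for the Poisson law. -/

section Poisson

open ProbabilityTheory
open scoped NNReal ENNReal

theorem lintegral_poissonMeasure (r : ℝ≥0) (g : ℕ → ℝ≥0∞) :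
    ∫⁻ n, g n ∂poissonMeasure r =
      ∑' n : ℕ, ENNReal.ofReal (Real.exp (-r) * r ^ n / n.factorial) * g n := by
  rw [lintegral_countable']
  refine tsum_congr fun n => ?_
  rw [poissonMeasure_singleton, mul_comm]

/-- The Stein–Chen identity `E[N g(N)] = r E[g(N + 1)]` of the Poisson law. -/
theorem lintegral_mul_poissonMeasure (r : ℝ≥0) (g : ℕ → ℝ≥0∞) :
    ∫⁻ n, n * g n ∂poissonMeasure r = r * ∫⁻ n, g (n + 1) ∂poissonMeasure r := by
  rw [lintegral_poissonMeasure, lintegral_poissonMeasure, tsum_eq_zero_add' ENNReal.summable,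
    ← ENNReal.tsum_mul_left]
  simp only [Nat.cast_zero, zero_mul, mul_zero, zero_add]
  refine tsum_congr fun n => ?_
  rw [← mul_assoc, ← mul_assoc, ← ENNReal.ofReal_natCast (n + 1),
    ← ENNReal.ofReal_coe_nnreal (p := r), ← ENNReal.ofReal_mul (by positivity),
    ← ENNReal.ofReal_mul (by positivity)]
  congr 2
  have : (n.factorial : ℝ) ≠ 0 := by positivity
  rw [Nat.factorial_succ]
  push_cast
  field_simp
  ring

theorem lintegral_id_poissonMeasure (r : ℝ≥0) :
    ∫⁻ n, (n : ℝ≥0∞) ∂poissonMeasure r = r := by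
  simpa using lintegral_mul_poissonMeasure r 1

/-- The indicator of `2 ≤ n` is at most `n (n - 1)`, and the second factorial moment is `r ^ 2` by
two applications of Stein–Chen. -/
theorem poissonMeasure_two_le (r : ℝ≥0) : poissonMeasure r {n | 2 ≤ n} ≤ (r : ℝ≥0∞) ^ 2 := by
  calc poissonMeasure r {n | 2 ≤ n}
      = ∫⁻ n, ({n | 2 ≤ n} : Set ℕ).indicator 1 n ∂poissonMeasure r :=
        (lintegral_indicator_one .of_discrete).symm
    _ ≤ ∫⁻ n, n * ((n - 1 : ℕ) : ℝ≥0∞) ∂poissonMeasure r := by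
        refine lintegral_mono fun n => ?_
        refine indicator_le (g := fun n : ℕ => (n : ℝ≥0∞) * ((n - 1 : ℕ) : ℝ≥0∞)) ?_ n
        intro n hn
        have h : 1 ≤ n * (n - 1) := Nat.mul_pos (by grind) (by grind)
        simp only [Pi.one_apply]
        exact_mod_cast h
    _ = r * r := by
        rw [lintegral_mul_poissonMeasure r fun n => ((n - 1 : ℕ) : ℝ≥0∞)]
        simp [lintegral_id_poissonMeasure]
    _ = r ^ 2 := (sq _).symm

end Poisson

/-! ### Configurations as Radon measures, and measurability of `toCone`. -/

section Configuration

open scoped NNReal ENNReal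

instance : LocallyCompactSpace PosReal := isOpen_Ioi.locallyCompactSpace

instance : PolishSpace PosReal := isOpen_Ioi.polishSpace

variable {X : Type*} [TopologicalSpace X] [PolishSpace X] [LocallyCompactSpace X]
  [MeasurableSpace X] [BorelSpace X]

theorem mem_borelCompact_of_subset {Y : Type*} [TopologicalSpace Y] [T2Space Y] [MeasurableSpace Y]
    {B C : Set Y} (hB : MeasurableSet B) (hC : IsCompact C) (h : B ⊆ C) : B ∈ BorelCompact Y :=
  ⟨hB, hC.closure_of_subset h⟩

theorem isPiSystem_borelCompact (Y : Type*) [TopologicalSpace Y] [MeasurableSpace Y] :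
    IsPiSystem (BorelCompact Y) := fun _ hA _ hB _ =>
  ⟨hA.1.inter hB.1, hA.2.of_isClosed_subset isClosed_closure (closure_mono inter_subset_left)⟩

theorem generateFrom_borelCompact (Y : Type*) [TopologicalSpace Y] [T2Space Y] [SigmaCompactSpace Y]
    [MeasurableSpace Y] [BorelSpace Y] :
    ‹MeasurableSpace Y› = .generateFrom (BorelCompact Y) := by
  refine le_antisymm (fun B hB => ?_) (MeasurableSpace.generateFrom_le fun B hB => hB.1)
  rw [← inter_univ B, ← iUnion_compactCovering Y, inter_iUnion]
  exact @MeasurableSet.iUnion _ _ (_) _ _ fun n => MeasurableSpace.measurableSet_generateFrom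
    (mem_borelCompact_of_subset
      (hB.inter (isCompact_compactCovering Y n).isClosed.measurableSet)
      (isCompact_compactCovering Y n) inter_subset_right)

theorem measure_lt_top_of_mem_borelCompact {Y : Type*} [TopologicalSpace Y] [MeasurableSpace Y]
    {m : Measure Y} [IsFiniteMeasureOnCompacts m] {B : Set Y} (hB : B ∈ BorelCompact Y) :
    m B < ∞ :=
  (measure_mono subset_closure).trans_lt hB.2.measure_lt_top

theorem isCompact_posReal_Icc {a b : ℝ} (ha : 0 < a) :
    IsCompact {s : PosReal | (s : ℝ) ∈ Icc a b} := by
  rw [Subtype.isCompact_iff]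
  convert isCompact_Icc (a := a) (b := b)
  ext x
  constructor
  · rintro ⟨s, hs, rfl⟩
    exact hs
  · exact fun hx => ⟨⟨x, ha.trans_le hx.1⟩, hx, rfl⟩

-- Compact sets in `(0, ∞) × X` stay away from weight `0`; hence finiteness on boxes `[a, b] × Λ`
-- gives finiteness on every relatively compact set.
omit [PolishSpace X] [LocallyCompactSpace X] [MeasurableSpace X] [BorelSpace X] in
theorem exists_subset_Icc_prod {C : Set (PosReal × X)} (hC : IsCompact C) :
    ∃ a b : ℝ, 0 < a ∧ a < b ∧ ∃ K : Set X, IsCompact K ∧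
      C ⊆ {p | (p.1 : ℝ) ∈ Icc a b ∧ p.2 ∈ K} := by
  have hc : IsCompact ((fun p : PosReal × X => (p.1 : ℝ)) '' C) := hC.image (by fun_prop)
  obtain ⟨a, ha, haC⟩ : ∃ a : ℝ, 0 < a ∧ ∀ p ∈ C, a ≤ (p.1 : ℝ) := by
    rcases C.eq_empty_or_nonempty with rfl | hne
    · exact ⟨1, one_pos, by simp⟩
    · obtain ⟨p, hp, hmin⟩ := hC.exists_isMinOn hne
        (f := fun p : PosReal × X => (p.1 : ℝ)) (by fun_prop)
      exact ⟨p.1, p.1.2, fun q hq => hmin hq⟩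
  obtain ⟨b, hb⟩ := hc.bddAbove
  refine ⟨a, max b (a + 1), ha, (lt_add_one a).trans_le (le_max_right _ _), Prod.snd '' C,
    hC.image continuous_snd, fun p hp => ⟨⟨haC p hp, ?_⟩, mem_image_of_mem _ hp⟩⟩
  exact (hb (mem_image_of_mem _ hp)).trans (le_max_left _ _)

omit [LocallyCompactSpace X] in
theorem Configuration.finite_inter (γ : Configuration X) {B : Set (PosReal × X)}
    (hB : B ∈ BorelCompact (PosReal × X)) : (γ.carrier ∩ B).Finite := by
  obtain ⟨a, b, ha, hab, K, hK, hsub⟩ := exists_subset_Icc_prod hB.2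
  exact (γ.locallyFinite K (mem_borelCompact_of_subset hK.isClosed.measurableSet hK subset_rfl) a b
    ha hab).subset (inter_subset_inter_right _ (subset_closure.trans hsub))

omit [LocallyCompactSpace X] in
theorem Configuration.toMeasure_apply (γ : Configuration X) {B : Set (PosReal × X)}
    (hB : B ∈ BorelCompact (PosReal × X)) : γ.toMeasure B = ((γ.carrier ∩ B).ncard : ℝ≥0∞) := by
  have h : γ.toMeasure B = ∑' p : γ.carrier, B.indicator 1 (p : PosReal × X) := by
    rw [Configuration.toMeasure, Measure.sum_apply _ hB.1]
    exact tsum_congr fun p => Measure.dirac_apply' _ hB.1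
  have hfin := γ.finite_inter hB
  rw [h, tsum_subtype γ.carrier (B.indicator (1 : PosReal × X → ℝ≥0∞)), indicator_indicator,
    ← tsum_subtype]
  simp only [Pi.one_apply, ENNReal.tsum_set_one]
  rw [← hfin.cast_ncard_eq]
  simp

instance (γ : Configuration X) : IsFiniteMeasureOnCompacts γ.toMeasure where
  lt_top_of_isCompact C hC := by
    rw [γ.toMeasure_apply (mem_borelCompact_of_subset hC.isClosed.measurableSet hC subset_rfl)]
    exact ENNReal.natCast_lt_top _

instance (η : DiscreteMeasure X) : IsFiniteMeasureOnCompacts η.toMeasure where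
  lt_top_of_isCompact := fun C hC => η.radon C hC

theorem continuous_integral_vague {Y T : Type*} [TopologicalSpace Y] [MeasurableSpace Y]
    (κ : T → Measure Y) (f : CompactlySupportedContinuousMap Y ℝ) :
    @Continuous T ℝ (vagueTopology κ) _ fun t => ∫ y, f y ∂κ t :=
  continuous_iff_le_induced.2 (iInf_le _ f)

theorem measurable_configuration_toMeasure :
    Measurable (Configuration.toMeasure : Configuration X → Measure (PosReal × X)) :=
  measurable_of_measurable_integral fun f =>
    (continuous_integral_vague Configuration.toMeasure f).measurable

theorem measurable_discreteMeasure_toMeasure :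
    Measurable (DiscreteMeasure.toMeasure : DiscreteMeasure X → Measure X) :=
  measurable_of_measurable_integral fun f =>
    (continuous_integral_vague DiscreteMeasure.toMeasure f).measurable

omit [TopologicalSpace X] [PolishSpace X] [LocallyCompactSpace X] [BorelSpace X] in
theorem measurable_mass {Λ : Set X} (hΛ : MeasurableSet Λ) :
    Measurable fun p : PosReal × X => ENNReal.ofReal (p.1 : ℝ) * Λ.indicator (1 : X → ℝ≥0∞) p.2 :=
  (measurable_subtype_coe.comp measurable_fst).ennreal_ofReal.mul
    ((measurable_one.indicator hΛ).comp measurable_snd)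

theorem measurable_localMass {Λ : Set X} (hΛ : MeasurableSet Λ) :
    Measurable fun γ : Configuration X => γ.localMass Λ :=
  (Measure.measurable_lintegral (measurable_mass hΛ)).comp measurable_configuration_toMeasure

theorem toCone_apply (γ : PinpointingFinite X) {Λ : Set X} (hΛ : MeasurableSet Λ) :
    (toCone γ).toMeasure Λ = γ.1.localMass Λ :=
  (γ.1.localMass_eq hΛ).symm

theorem measurable_toCone : Measurable (toCone : PinpointingFinite X → DiscreteMeasure X) := by
  refine measurable_into_vague DiscreteMeasure.toMeasure ?_
  refine Measure.measurable_of_measurable_coe _ fun Λ hΛ => ?_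
  simp only [toCone_apply _ hΛ]
  exact (measurable_localMass hΛ).comp measurable_subtype_coe

end Configuration

/-! ### First consequences of the Poisson property; Campbell's formula. -/

section Campbell

open ProbabilityTheory
open scoped NNReal ENNReal

variable {X : Type*} [TopologicalSpace X] [PolishSpace X] [LocallyCompactSpace X]
  [MeasurableSpace X] [BorelSpace X] {m : Measure (PosReal × X)} {π : Measure (Configuration X)}

namespace IsPoissonMeasure

-- `Measure.map` is `0` along a function that is not a.e. measurable, whereas a Poisson law is
-- nonzero.
omit [PolishSpace X] [LocallyCompactSpace X] [BorelSpace X] in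
theorem aemeasurable_count (hπ : IsPoissonMeasure m π) {B : Set (PosReal × X)}
    (hB : B ∈ BorelCompact (PosReal × X)) :
    AEMeasurable (fun γ : Configuration X => (γ.carrier ∩ B).ncard) π := by
  refine AEMeasurable.of_map_ne_zero ?_
  rw [hπ.count_law B hB]
  exact IsProbabilityMeasure.ne_zero _

-- Total mass one is read off from the law of the count in the empty set.
omit [LocallyCompactSpace X] [PolishSpace X] [BorelSpace X] in
theorem isProbabilityMeasure (hπ : IsPoissonMeasure m π) : IsProbabilityMeasure π := by
  have h : (∅ : Set (PosReal × X)) ∈ BorelCompact (PosReal × X) := ⟨.empty, by simp⟩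
  have : IsProbabilityMeasure (π.map fun γ => (γ.carrier ∩ ∅).ncard) := by
    rw [hπ.count_law _ h]
    infer_instance
  exact (Measure.isProbabilityMeasure_map_iff (hπ.aemeasurable_count h)).1 this

omit [PolishSpace X] [LocallyCompactSpace X] [BorelSpace X] in
theorem lintegral_count (hπ : IsPoissonMeasure m π) {B : Set (PosReal × X)}
    (hB : B ∈ BorelCompact (PosReal × X)) (g : ℕ → ℝ≥0∞) :
    ∫⁻ γ, g (γ.carrier ∩ B).ncard ∂π = ∫⁻ n, g n ∂poissonMeasure (m B).toNNReal := by
  rw [← hπ.count_law B hB, lintegral_map' (by fun_prop) (hπ.aemeasurable_count hB)]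

variable [IsFiniteMeasureOnCompacts m]

/-- The intensity measure of a Poisson measure is its mean measure. -/
theorem bind_toMeasure (hπ : IsPoissonMeasure m π) : π.bind Configuration.toMeasure = m := by
  have h : ∀ B ∈ BorelCompact (PosReal × X), π.bind Configuration.toMeasure B = m B := by
    intro B hB
    rw [Measure.bind_apply hB.1 measurable_configuration_toMeasure.aemeasurable]
    simp only [Configuration.toMeasure_apply _ hB]
    rw [hπ.lintegral_count hB fun n => (n : ℝ≥0∞), lintegral_id_poissonMeasure]
    exact ENNReal.coe_toNNReal (measure_lt_top_of_mem_borelCompact hB).ne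
  have hK : ∀ n, compactCovering (PosReal × X) n ∈ BorelCompact (PosReal × X) := fun n =>
    mem_borelCompact_of_subset (isCompact_compactCovering _ n).isClosed.measurableSet
      (isCompact_compactCovering _ n) subset_rfl
  refine Measure.ext_of_generateFrom_of_iUnion _ (compactCovering (PosReal × X))
    (generateFrom_borelCompact _) (isPiSystem_borelCompact _) (iUnion_compactCovering _) hK ?_ h
  intro n
  rw [h _ (hK n)]
  exact (measure_lt_top_of_mem_borelCompact (hK n)).ne

/-- Campbell's formula. -/
theorem lintegral_lintegral (hπ : IsPoissonMeasure m π) {f : PosReal × X → ℝ≥0∞}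
    (hf : Measurable f) : ∫⁻ γ, ∫⁻ p, f p ∂γ.toMeasure ∂π = ∫⁻ p, f p ∂m := by
  conv_rhs => rw [← hπ.bind_toMeasure]
  exact (Measure.lintegral_bind measurable_configuration_toMeasure.aemeasurable
    hf.aemeasurable).symm

omit [PolishSpace X] [LocallyCompactSpace X] [BorelSpace X] in
theorem measure_two_le_count (hπ : IsPoissonMeasure m π) {B : Set (PosReal × X)}
    (hB : B ∈ BorelCompact (PosReal × X)) :
    π {γ | 2 ≤ (γ.carrier ∩ B).ncard} ≤ m B ^ 2 := by
  have h := poissonMeasure_two_le (m B).toNNReal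
  rwa [← hπ.count_law B hB, Measure.map_apply_of_aemeasurable (hπ.aemeasurable_count hB)
    .of_discrete, ENNReal.coe_toNNReal (measure_lt_top_of_mem_borelCompact hB).ne] at h

end IsPoissonMeasure

end Campbell

/-! ### The Poisson measure is carried by `PinpointingFinite X`. -/

section Support

open ProbabilityTheory
open scoped NNReal ENNReal

/-- A locally finite measure without atoms admits countable partitions into small pieces. -/
theorem exists_partition_measure_le {X : Type*} [TopologicalSpace X] [PolishSpace X]
    [MeasurableSpace X] [BorelSpace X] (σ : Measure X)
    [IsLocallyFiniteMeasure σ] [NullSingletonClass σ] {ε : ℝ≥0∞} (hε : 0 < ε) :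
    ∃ V : ℕ → Set X, (∀ n, MeasurableSet (V n)) ∧ Pairwise (fun i j => Disjoint (V i) (V j)) ∧
      ⋃ n, V n = univ ∧ ∀ n, σ (V n) ≤ ε := by
  let := TopologicalSpace.upgradeIsCompletelyMetrizable X
  have hU : ∀ x : X, ∃ U, x ∈ U ∧ IsOpen U ∧ σ U < ε := fun x => by
    obtain ⟨U, hxU, hUo, hUε⟩ := ({x} : Set X).exists_isOpen_lt_of_lt (μ := σ) ε (by simpa using hε)
    exact ⟨U, hxU rfl, hUo, hUε⟩
  choose U hxU hUo hUε using hU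
  obtain ⟨s, hs, hsU⟩ := TopologicalSpace.countable_cover_nhds fun x => (hUo x).mem_nhds (hxU x)
  obtain ⟨W, hW⟩ : ∃ W : ℕ → Set X, (∀ n, IsOpen (W n) ∧ σ (W n) ≤ ε) ∧ ⋃ n, W n = univ := by
    rcases s.eq_empty_or_nonempty with rfl | hne
    · exact ⟨fun _ => ∅, by simp, by simpa using hsU⟩
    · obtain ⟨e, he⟩ := hs.exists_eq_range hne
      refine ⟨fun n => U (e n), fun n => ⟨hUo _, (hUε _).le⟩, ?_⟩
      rw [he, biUnion_range] at hsU
      exact hsU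
  refine ⟨disjointed W, fun n => .disjointed (fun n => (hW.1 n).1.measurableSet) n,
    disjoint_disjointed W, ?_, fun n => (measure_mono (disjointed_subset W n)).trans (hW.1 n).2⟩
  rw [iUnion_disjointed, hW.2]

variable {X : Type*} [TopologicalSpace X] [PolishSpace X] [LocallyCompactSpace X]
  [MeasurableSpace X] [BorelSpace X] {π : Measure (Configuration X)}
  {ν : Measure PosReal} [IsLocallyFiniteMeasure ν] {σ : Measure X} [IsLocallyFiniteMeasure σ]

omit [LocallyCompactSpace X] [BorelSpace X] in
theorem prod_mem_borelCompact {a b : ℝ} (ha : 0 < a) {I : Set PosReal} (hI : MeasurableSet I)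
    (hIab : ∀ s ∈ I, (s : ℝ) ∈ Icc a b) {Λ : Set X} (hΛ : Λ ∈ BorelCompact X) :
    I ×ˢ Λ ∈ BorelCompact (PosReal × X) :=
  mem_borelCompact_of_subset (hI.prod hΛ.1) ((isCompact_posReal_Icc ha).prod hΛ.2)
    (prod_mono hIab subset_closure)

/-- Cut `Λ` into pieces of `σ`-measure at most `ε`, which is possible as `σ` has no atoms. Two
points over one location share a piece, an event of probability at most the square of the intensity
there. The squares sum to at most `ε * ν(I) ^ 2 * σ(Λ)`, with `ε` arbitrary. -/
theorem measure_not_pinpointing_compact [NullSingletonClass σ]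
    (hπ : IsPoissonMeasure (ν.prod σ) π) {a b : ℝ} (ha : 0 < a) {Λ : Set X}
    (hΛ : Λ ∈ BorelCompact X) :
    π {γ | ∃ p ∈ γ.carrier, ∃ q ∈ γ.carrier, p ≠ q ∧ p.2 = q.2 ∧ (p.1 : ℝ) ∈ Icc a b ∧
      (q.1 : ℝ) ∈ Icc a b ∧ p.2 ∈ Λ} = 0 := by
  set I : Set PosReal := {s | (s : ℝ) ∈ Icc a b} with hI
  have hIc : IsCompact I := isCompact_posReal_Icc ha
  have hIm : MeasurableSet I := hIc.isClosed.measurableSet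
  by_contra hne
  have hfin : ν I * (ν I * σ Λ) ≠ ∞ := ENNReal.mul_ne_top hIc.measure_lt_top.ne
    (ENNReal.mul_ne_top hIc.measure_lt_top.ne (measure_lt_top_of_mem_borelCompact hΛ).ne)
  -- If the event had positive probability, some `ε > 0` would make the final bound strictly smaller
  -- than it.
  obtain ⟨ε, hε, hlt⟩ := ENNReal.exists_nnreal_pos_mul_lt hfin hne
  obtain ⟨V, hVm, hVd, hVu, hVε⟩ :=
    exists_partition_measure_le σ (ε := (ε : ℝ≥0∞)) (by exact_mod_cast hε)
  have hΛn : ∀ n, Λ ∩ V n ∈ BorelCompact X := fun n =>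
    mem_borelCompact_of_subset (hΛ.1.inter (hVm n)) hΛ.2 (inter_subset_left.trans subset_closure)
  have hB : ∀ n, I ×ˢ (Λ ∩ V n) ∈ BorelCompact (PosReal × X) := fun n =>
    prod_mem_borelCompact ha hIm (fun s hs => hs) (hΛn n)
  refine hlt.not_ge ?_
  calc _ ≤ π (⋃ n, {γ | 2 ≤ (γ.carrier ∩ I ×ˢ (Λ ∩ V n)).ncard}) := by
        refine measure_mono ?_
        rintro γ ⟨p, hp, q, hq, hpq, hpq2, hpI, hqI, hpΛ⟩
        obtain ⟨n, hn⟩ := mem_iUnion.1 (hVu.symm ▸ mem_univ p.2 : p.2 ∈ ⋃ n, V n)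
        refine mem_iUnion.2 ⟨n, ?_⟩
        refine (one_lt_ncard (γ.finite_inter (hB n))).2
          ⟨p, ⟨hp, hpI, hpΛ, hn⟩, q, ⟨hq, hqI, ?_⟩, hpq⟩
        rw [← hpq2]
        exact ⟨hpΛ, hn⟩
    _ ≤ ∑' n, π {γ | 2 ≤ (γ.carrier ∩ I ×ˢ (Λ ∩ V n)).ncard} := measure_iUnion_le _
    _ ≤ ∑' n, ε * (ν I * ν I) * σ (Λ ∩ V n) := by
        refine ENNReal.tsum_le_tsum fun n => (hπ.measure_two_le_count (hB n)).trans ?_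
        rw [Measure.prod_prod, sq]
        calc ν I * σ (Λ ∩ V n) * (ν I * σ (Λ ∩ V n))
            ≤ ν I * ε * (ν I * σ (Λ ∩ V n)) := by
              gcongr
              exact (measure_mono inter_subset_right).trans (hVε n)
          _ = ε * (ν I * ν I) * σ (Λ ∩ V n) := by ring
    _ = ε * (ν I * ν I) * σ Λ := by
        rw [ENNReal.tsum_mul_left, ← measure_iUnion, ← inter_iUnion, hVu, inter_univ]
        · exact fun i j hij => (hVd hij).mono inter_subset_right inter_subset_right
        · exact fun n => hΛ.1.inter (hVm n)
    _ = ε * (ν I * (ν I * σ Λ)) := by ring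

omit [LocallyCompactSpace X] [BorelSpace X] [IsLocallyFiniteMeasure ν] in
theorem lintegral_pow_mul_indicator {Λ : Set X} (hΛ : MeasurableSet Λ) (n : ℕ) :
    ∫⁻ p : PosReal × X, ENNReal.ofReal ((p.1 : ℝ) ^ n) * Λ.indicator (1 : X → ℝ≥0∞) p.2
      ∂(ν.prod σ) = (∫⁻ s, ENNReal.ofReal ((s : ℝ) ^ n) ∂ν) * σ Λ := by
  rw [lintegral_prod_mul (f := fun s : PosReal => ENNReal.ofReal ((s : ℝ) ^ n))
    (g := Λ.indicator (1 : X → ℝ≥0∞)) (by fun_prop) (measurable_one.indicator hΛ).aemeasurable,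
    lintegral_indicator_one hΛ]

theorem lintegral_localMass (hπ : IsPoissonMeasure (ν.prod σ) π) {Λ : Set X}
    (hΛ : MeasurableSet Λ) :
    ∫⁻ γ, γ.localMass Λ ∂π = (∫⁻ s, ENNReal.ofReal (s : ℝ) ∂ν) * σ Λ := by
  have h := lintegral_pow_mul_indicator (ν := ν) (σ := σ) hΛ 1
  simp only [pow_one] at h
  rw [← h]
  exact hπ.lintegral_lintegral (measurable_mass hΛ)

/-- The Poisson measure is carried by the pinpointing configurations of finite local mass. -/
theorem ae_mem_pinpointingFinite [NullSingletonClass σ] (hπ : IsPoissonMeasure (ν.prod σ) π)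
    (hν : ∫⁻ s, ENNReal.ofReal (s : ℝ) ∂ν < ∞) : ∀ᵐ γ ∂π, γ ∈ PinpointingFinite X := by
  let K := CompactExhaustion.choice X
  have hK : ∀ n, K n ∈ BorelCompact X := fun n =>
    mem_borelCompact_of_subset (K.isCompact n).isClosed.measurableSet (K.isCompact n) subset_rfl
  have h1 : ∀ᵐ γ ∂π, ∀ n : ℕ, ¬ ∃ p ∈ γ.carrier, ∃ q ∈ γ.carrier, p ≠ q ∧ p.2 = q.2 ∧
      (p.1 : ℝ) ∈ Icc (1 / ((n : ℝ) + 1)) n ∧ (q.1 : ℝ) ∈ Icc (1 / ((n : ℝ) + 1)) n ∧ p.2 ∈ K n :=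
    ae_all_iff.2 fun n => by
      simpa only [ae_iff, not_not] using
        measure_not_pinpointing_compact hπ (by positivity : (0 : ℝ) < 1 / ((n : ℝ) + 1)) (hK n)
  have h2 : ∀ᵐ γ ∂π, ∀ n : ℕ, γ.localMass (K n) < ∞ := ae_all_iff.2 fun n => by
    refine ae_lt_top (measurable_localMass (hK n).1) ?_
    rw [lintegral_localMass hπ (hK n).1]
    exact ENNReal.mul_ne_top hν.ne (measure_lt_top_of_mem_borelCompact (hK n)).ne
  filter_upwards [h1, h2] with γ hγ1 hγ2
  refine ⟨fun p hp q hq hpq => ?_, fun Λ hΛ => ?_⟩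
  · by_contra hne
    have hev : ∀ s : PosReal, ∀ᶠ n : ℕ in Filter.atTop, (s : ℝ) ∈ Icc (1 / ((n : ℝ) + 1)) n :=
      fun s => ((tendsto_one_div_add_atTop_nhds_zero_nat (𝕜 := ℝ)).eventually_le_const s.2).and
        (tendsto_natCast_atTop_atTop.eventually_ge_atTop (s : ℝ))
    obtain ⟨n₀, hn₀⟩ := K.exists_mem p.2
    obtain ⟨n, hn, hpn, hqn⟩ := ((Filter.eventually_ge_atTop n₀).and
      ((hev p.1).and (hev q.1))).exists
    exact hγ1 n ⟨p, hp, q, hq, fun h => hne (h ▸ rfl), hpq, hpn, hqn, K.subset hn hn₀⟩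
  · obtain ⟨n, hn⟩ := K.exists_superset_of_isCompact hΛ.2
    refine lt_of_le_of_lt (lintegral_mono fun p => ?_) (hγ2 n)
    gcongr
    exact subset_closure.trans hn

end Support

/-! ### Transfer of moments from configurations to the cone. -/

section ConeLaw

open scoped ENNReal

variable {X : Type*} [TopologicalSpace X] [PolishSpace X] [LocallyCompactSpace X]
  [MeasurableSpace X] [BorelSpace X] {π : Measure (Configuration X)}

-- Full measure makes `PinpointingFinite X` null-measurable, which suffices for `comap` to be the
-- genuine trace of `π`; Borel measurability of this set is not needed.
omit [PolishSpace X] [LocallyCompactSpace X] [BorelSpace X] in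
theorem map_comap_pinpointingFinite (h : ∀ᵐ γ ∂π, γ ∈ PinpointingFinite X) :
    (π.comap ((↑) : PinpointingFinite X → Configuration X)).map (↑) = π := by
  have hnull : NullMeasurableSet (PinpointingFinite X) π :=
    NullMeasurableSet.of_compl (NullMeasurableSet.of_null h)
  have himage : ∀ s : Set (PinpointingFinite X), MeasurableSet s →
      NullMeasurableSet ((↑) '' s : Set (Configuration X)) π := by
    rintro _ ⟨t, ht, rfl⟩
    rw [Subtype.image_preimage_coe]
    exact hnull.inter ht.nullMeasurableSet
  ext t ht
  rw [Measure.map_apply measurable_subtype_coe ht, Measure.comap_apply₀ _ _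
    Subtype.coe_injective himage (measurable_subtype_coe ht).nullMeasurableSet,
    Subtype.image_preimage_coe, inter_comm]
  exact measure_inter_conull h

theorem isProbabilityMeasure_coneLaw [IsProbabilityMeasure π]
    (h : ∀ᵐ γ ∂π, γ ∈ PinpointingFinite X) : IsProbabilityMeasure (coneLaw π) := by
  have h1 : IsProbabilityMeasure
      ((π.comap ((↑) : PinpointingFinite X → Configuration X)).map
        ((↑) : PinpointingFinite X → Configuration X)) := by
    rwa [map_comap_pinpointingFinite h]
  have := (Measure.isProbabilityMeasure_map_iff measurable_subtype_coe.aemeasurable).1 h1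
  exact (Measure.isProbabilityMeasure_map_iff measurable_toCone.aemeasurable).2 this

theorem lintegral_coneLaw (h : ∀ᵐ γ ∂π, γ ∈ PinpointingFinite X) {Λ : Set X}
    (hΛ : MeasurableSet Λ) (n : ℕ) :
    ∫⁻ η, η.toMeasure Λ ^ n ∂coneLaw π = ∫⁻ γ, γ.localMass Λ ^ n ∂π := by
  have hm : Measurable fun η : DiscreteMeasure X => η.toMeasure Λ ^ n :=
    ((Measure.measurable_coe hΛ).comp measurable_discreteMeasure_toMeasure).pow_const n
  rw [coneLaw, lintegral_map hm measurable_toCone]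
  conv_rhs => rw [← map_comap_pinpointingFinite h,
    lintegral_map ((measurable_localMass hΛ).pow_const n) measurable_subtype_coe]
  simp only [toCone_apply _ hΛ]

end ConeLaw

/-! ### Moments of linear combinations of independent Poisson variables. -/

section Moments

open ProbabilityTheory
open scoped NNReal ENNReal

theorem ennreal_add_pow_le (x y : ℝ≥0∞) (n : ℕ) : (x + y) ^ n ≤ 2 ^ n * (x ^ n + y ^ n) := by
  calc (x + y) ^ n ≤ (2 * max x y) ^ n := by
        rw [two_mul]
        gcongr
        · exact le_max_left _ _
        · exact le_max_right _ _
    _ = 2 ^ n * max x y ^ n := mul_pow _ _ _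
    _ ≤ 2 ^ n * (x ^ n + y ^ n) := by
        gcongr
        rcases le_total x y with h | h
        · rw [max_eq_right h]
          exact le_add_self
        · rw [max_eq_left h]
          exact le_self_add

theorem tsum_pow_succ_le {ι : Type*} (a : ι → ℝ≥0∞) (n : ℕ) :
    ∑' i, a i ^ (n + 1) ≤ (∑' i, a i) ^ (n + 1) := by
  rw [pow_succ, ← ENNReal.tsum_mul_left]
  refine ENNReal.tsum_le_tsum fun i => ?_
  rw [pow_succ]
  gcongr
  exact ENNReal.le_tsum i

variable {Ω : Type*} [MeasurableSpace Ω] {P : Measure Ω} [IsProbabilityMeasure P]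

/-- The Stein–Chen identity in presence of an independent variable. -/
theorem lintegral_poisson_mul {N : Ω → ℕ} {T : Ω → ℝ≥0∞} {r : ℝ≥0} (hN : AEMeasurable N P)
    (hlaw : P.map N = poissonMeasure r) (hT : AEMeasurable T P) (hNT : IndepFun N T P)
    {G : ℕ × ℝ≥0∞ → ℝ≥0∞} (hG : Measurable G) :
    ∫⁻ ω, N ω * G (N ω, T ω) ∂P = r * ∫⁻ ω, G (N ω + 1, T ω) ∂P := by
  have hprod := (indepFun_iff_map_prod_eq_prod_map_map hN hT).1 hNT
  have := Measure.isProbabilityMeasure_map hT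
  have key : ∀ F : ℕ × ℝ≥0∞ → ℝ≥0∞, Measurable F →
      ∫⁻ ω, F (N ω, T ω) ∂P = ∫⁻ t, ∫⁻ n, F (n, t) ∂poissonMeasure r ∂(P.map T) := by
    intro F hF
    rw [← lintegral_map' hF.aemeasurable (hN.prodMk hT), hprod, hlaw,
      lintegral_prod_symm _ hF.aemeasurable]
  rw [key (fun z => z.1 * G z) (by fun_prop), key (fun z => G (z.1 + 1, z.2)) (by fun_prop),
    ← lintegral_const_mul _ (by fun_prop)]
  exact lintegral_congr fun t => lintegral_mul_poissonMeasure r fun n => G (n, t)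

/-- Moment recursion for a linear combination of independent Poisson variables. -/
theorem lintegral_sum_pow_succ_le {ι : Type*} [Fintype ι] {N : ι → Ω → ℕ} {r : ι → ℝ≥0}
    (hN : ∀ i, AEMeasurable (N i) P) (hlaw : ∀ i, P.map (N i) = poissonMeasure (r i))
    (hind : iIndepFun N P) (a : ι → ℝ≥0∞) (n : ℕ) :
    ∫⁻ ω, (∑ i, a i * N i ω) ^ (n + 1) ∂P ≤ 2 ^ n * ((∑ i, a i * r i) *
      ∫⁻ ω, (∑ i, a i * N i ω) ^ n ∂P + ∑ i, a i ^ (n + 1) * r i) := by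
  classical
  set S : Ω → ℝ≥0∞ := fun ω => ∑ i, a i * N i ω with hS
  have hSm : AEMeasurable S P := Finset.aemeasurable_fun_sum _ fun i _ => by
    have := hN i
    fun_prop
  have hterm : ∀ i, ∫⁻ ω, N i ω * S ω ^ n ∂P ≤ r i * (2 ^ n * (∫⁻ ω, S ω ^ n ∂P + a i ^ n)) := by
    intro i
    -- `T` is the part of `S` without the index `i`, hence independent of `N i`. The shift `N i + 1`
    -- in Stein–Chen then replaces `S` by `S + a i`.
    set T : Ω → ℝ≥0∞ := fun ω => ∑ j ∈ Finset.univ.erase i, a j * N j ω with hT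
    have hST : ∀ ω, S ω = a i * N i ω + T ω := fun ω =>
      (Finset.add_sum_erase _ (fun j => a j * (N j ω : ℝ≥0∞)) (Finset.mem_univ i)).symm
    have hTm : AEMeasurable T P := Finset.aemeasurable_fun_sum _ fun j _ => by
      have := hN j
      fun_prop
    have hNT : IndepFun (N i) T P := by
      have h := hind.indepFun_finset₀ {i} (Finset.univ.erase i) (by simp) hN
      have h1 : Measurable fun v : ({i} : Finset ι) → ℕ => v ⟨i, by simp⟩ := by fun_prop
      have h2 : Measurable fun v : ↥(Finset.univ.erase i) → ℕ =>
          ∑ j : ↥(Finset.univ.erase i), a j * (v j : ℝ≥0∞) := by fun_prop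
      refine (h.comp h1 h2).congr .rfl (.of_forall fun ω => ?_)
      exact (Finset.sum_coe_sort (Finset.univ.erase i) fun j => a j * (N j ω : ℝ≥0∞))
    have h := lintegral_poisson_mul (hN i) (hlaw i) hTm hNT
      (G := fun z => (a i * z.1 + z.2) ^ n) (by fun_prop)
    simp only [← hST] at h
    rw [h]
    gcongr
    calc ∫⁻ ω, (a i * ((N i ω + 1 : ℕ) : ℝ≥0∞) + T ω) ^ n ∂P
        = ∫⁻ ω, (S ω + a i) ^ n ∂P := by
          refine lintegral_congr fun ω => ?_
          rw [hST]
          push_cast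
          ring
      _ ≤ ∫⁻ ω, 2 ^ n * (S ω ^ n + a i ^ n) ∂P :=
          lintegral_mono fun ω => ennreal_add_pow_le _ _ _
      _ = 2 ^ n * (∫⁻ ω, S ω ^ n ∂P + a i ^ n) := by
          rw [lintegral_const_mul'' _ (by fun_prop), lintegral_add_right _ measurable_const]
          simp
  -- Only one factor `S` of `S ^ (n + 1)` is expanded, which puts every term in the form treated by
  -- `hterm`.
  calc ∫⁻ ω, S ω ^ (n + 1) ∂P = ∫⁻ ω, ∑ i, a i * (N i ω * S ω ^ n) ∂P := by
        refine lintegral_congr fun ω => ?_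
        rw [pow_succ', hS, Finset.sum_mul]
        simp only [mul_assoc]
    _ = ∑ i, a i * ∫⁻ ω, N i ω * S ω ^ n ∂P := by
        rw [lintegral_finsetSum' _ fun i _ => by
          have := hN i
          fun_prop]
        refine Finset.sum_congr rfl fun i _ => lintegral_const_mul'' _ ?_
        have := hN i
        fun_prop
    _ ≤ ∑ i, a i * (r i * (2 ^ n * (∫⁻ ω, S ω ^ n ∂P + a i ^ n))) := by
        gcongr with i
        exact hterm i
    _ = _ := by
        rw [Finset.sum_mul, ← Finset.sum_add_distrib, Finset.mul_sum]
        refine Finset.sum_congr rfl fun i _ => ?_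
        ring

/-- Linear combinations of independent Poisson variables have moments bounded in terms of
`∑ᵢ aᵢ ^ n rᵢ` only. -/
theorem exists_lintegral_sum_pow_le {N : ℕ → Ω → ℕ} {r : ℕ → ℝ≥0}
    (hN : ∀ i, AEMeasurable (N i) P) (hlaw : ∀ i, P.map (N i) = poissonMeasure (r i))
    (hind : ∀ k, iIndepFun (fun i : Fin k => N i) P) (a : ℕ → ℝ≥0∞)
    (ha : ∀ n, 1 ≤ n → ∑' i, a i ^ n * r i < ∞) (n : ℕ) :
    ∃ C < ∞, ∀ k, ∫⁻ ω, (∑ i : Fin k, a i * N i ω) ^ n ∂P ≤ C := by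
  induction n with
  | zero => exact ⟨1, ENNReal.one_lt_top, fun k => by simp⟩
  | succ n ih =>
    obtain ⟨C, hC, hle⟩ := ih
    have h1 := ha 1 le_rfl
    have h2 := ha (n + 1) (by omega)
    refine ⟨2 ^ n * ((∑' i, a i ^ 1 * r i) * C + ∑' i, a i ^ (n + 1) * r i), ?_, fun k => ?_⟩
    · exact ENNReal.mul_lt_top (by simp)
        (ENNReal.add_lt_top.2 ⟨ENNReal.mul_lt_top h1 hC, h2⟩)
    · have hfin : ∀ f : ℕ → ℝ≥0∞, ∑ i : Fin k, f i ≤ ∑' i, f i := fun f => by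
        rw [Fin.sum_univ_eq_sum_range f k]
        exact ENNReal.sum_le_tsum _
      refine (lintegral_sum_pow_succ_le (fun i : Fin k => hN i) (fun i => hlaw i) (hind k)
        (fun i => a i) n).trans ?_
      gcongr
      · simpa using hfin fun i => a i * r i
      · exact hle k
      · exact hfin fun i => a i ^ (n + 1) * r i

/-- Fatou's lemma passes to the series because the bound for the partial sums does not depend on
their length. -/
theorem lintegral_tsum_pow_lt_top {N : ℕ → Ω → ℕ} {r : ℕ → ℝ≥0}
    (hN : ∀ i, AEMeasurable (N i) P) (hlaw : ∀ i, P.map (N i) = poissonMeasure (r i))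
    (hind : ∀ k, iIndepFun (fun i : Fin k => N i) P) (a : ℕ → ℝ≥0∞)
    (ha : ∀ n, 1 ≤ n → ∑' i, a i ^ n * r i < ∞) (n : ℕ) :
    ∫⁻ ω, (∑' i, a i * N i ω) ^ n ∂P < ∞ := by
  obtain ⟨C, hC, hle⟩ := exists_lintegral_sum_pow_le hN hlaw hind a ha n
  refine lt_of_le_of_lt ?_ hC
  have hlim : ∀ ω, Filter.Tendsto (fun k => (∑ i ∈ Finset.range k, a i * N i ω) ^ n) Filter.atTop
      (nhds ((∑' i, a i * N i ω) ^ n)) := fun ω =>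
    ((ENNReal.continuous_pow n).tendsto _).comp (ENNReal.tendsto_nat_tsum _)
  simp only [← (hlim _).liminf_eq]
  refine (lintegral_liminf_le' fun k => ?_).trans ?_
  · refine (Finset.aemeasurable_fun_sum _ fun i _ => ?_).pow_const n
    have := hN i
    fun_prop
  · refine Filter.liminf_le_of_frequently_le' (Filter.Frequently.of_forall fun k => ?_)
    simpa only [← Fin.sum_univ_eq_sum_range (fun i => a i * (N i _ : ℝ≥0∞))] using hle k

end Moments

/-! ### Two-sided control of the moments of the local mass. -/

section LocalMoments

open ProbabilityTheory
open scoped NNReal ENNReal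

variable {X : Type*} [TopologicalSpace X] [PolishSpace X] [LocallyCompactSpace X]
  [MeasurableSpace X] [BorelSpace X] {π : Measure (Configuration X)}
  {ν : Measure PosReal} [IsLocallyFiniteMeasure ν] {σ : Measure X} [IsLocallyFiniteMeasure σ]

/-- The dyadic interval `(2 ^ k, 2 ^ (k + 1)]`. -/
def dyadic (k : ℤ) : Set PosReal := {s | (s : ℝ) ∈ Ioc ((2 : ℝ) ^ k) (2 ^ (k + 1))}

theorem measurableSet_dyadic (k : ℤ) : MeasurableSet (dyadic k) :=
  measurable_subtype_coe measurableSet_Ioc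

theorem pairwise_disjoint_dyadic : Pairwise (fun i j => Disjoint (dyadic i) (dyadic j)) := by
  have hmono : Monotone fun k : ℤ => (2 : ℝ) ^ k := zpow_right_mono₀ one_le_two
  intro i j hij
  exact Disjoint.preimage _ (hmono.pairwise_disjoint_on_Ioc_succ hij)

theorem iUnion_dyadic : ⋃ k, dyadic k = univ :=
  eq_univ_of_forall fun s => mem_iUnion.2 (exists_mem_Ioc_zpow s.2 one_lt_two)

/-- For each configuration the sum of `n`-th powers of weights is at most the `n`-th power of their
sum (`tsum_pow_succ_le`); Campbell's formula computes the mean of the former. -/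
theorem lintegral_pow_le_localMass_pow (hπ : IsPoissonMeasure (ν.prod σ) π) {Λ : Set X}
    (hΛ : MeasurableSet Λ) {n : ℕ} (hn : 1 ≤ n) :
    (∫⁻ s, ENNReal.ofReal ((s : ℝ) ^ n) ∂ν) * σ Λ ≤ ∫⁻ γ, γ.localMass Λ ^ n ∂π := by
  have hm : Measurable fun p : PosReal × X =>
      ENNReal.ofReal ((p.1 : ℝ) ^ n) * Λ.indicator (1 : X → ℝ≥0∞) p.2 :=
    ((measurable_subtype_coe.comp measurable_fst).pow_const n).ennreal_ofReal.mul
      ((measurable_one.indicator hΛ).comp measurable_snd)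
  rw [← lintegral_pow_mul_indicator hΛ, ← hπ.lintegral_lintegral hm]
  refine lintegral_mono fun γ => ?_
  obtain ⟨k, rfl⟩ := Nat.exists_eq_add_of_le' hn
  simp only [Configuration.localMass, Configuration.toMeasure, lintegral_sum_measure]
  simp only [lintegral_dirac' _ hm, lintegral_dirac' _ (measurable_mass hΛ)]
  refine le_trans (ENNReal.tsum_le_tsum fun p => ?_) (tsum_pow_succ_le _ k)
  rw [mul_pow, ENNReal.ofReal_pow p.1.1.2.le]
  gcongr
  by_cases hp : p.1.2 ∈ Λ <;> simp [hp]

omit [LocallyCompactSpace X] in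
theorem localMass_le_tsum_dyadic (γ : Configuration X) {Λ : Set X} (hΛ : Λ ∈ BorelCompact X)
    (e : ℕ ≃ ℤ) : γ.localMass Λ ≤ ∑' i, ENNReal.ofReal ((2 : ℝ) ^ (e i + 1)) *
      ((γ.carrier ∩ dyadic (e i) ×ˢ Λ).ncard : ℝ≥0∞) := by
  have hB : ∀ k, dyadic k ×ˢ Λ ∈ BorelCompact (PosReal × X) := fun k =>
    prod_mem_borelCompact (a := 2 ^ k) (by positivity) (measurableSet_dyadic k)
      (fun s hs => Ioc_subset_Icc_self hs) hΛ
  calc γ.localMass Λ ≤ ∫⁻ p, ∑' i, ENNReal.ofReal ((2 : ℝ) ^ (e i + 1)) *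
        (dyadic (e i) ×ˢ Λ).indicator 1 p ∂γ.toMeasure := by
        refine lintegral_mono fun p => ?_
        by_cases hp : p.2 ∈ Λ
        · obtain ⟨k, hk⟩ := mem_iUnion.1 (iUnion_dyadic.symm ▸ mem_univ p.1 : p.1 ∈ ⋃ k, dyadic k)
          refine le_trans ?_ (ENNReal.le_tsum (e.symm k))
          rw [e.apply_symm_apply, indicator_of_mem hp,
            indicator_of_mem (show p ∈ dyadic k ×ˢ Λ from ⟨hk, hp⟩)]
          exact mul_le_mul_left (ENNReal.ofReal_le_ofReal hk.2) _
        · simp [hp]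
    _ = _ := by
        rw [lintegral_tsum fun i => ((measurable_one.indicator (hB _).1).const_mul _).aemeasurable]
        refine tsum_congr fun i => ?_
        rw [lintegral_const_mul _ (measurable_one.indicator (hB _).1),
          lintegral_indicator_one (hB _).1, γ.toMeasure_apply (hB _)]

/-- On the `k`-th dyadic interval `2 ^ (k + 1) ≤ 2 * s`, so rounding up costs a factor `2 ^ n` at
order `n`. -/
theorem tsum_dyadic_le (ν : Measure PosReal) (e : ℕ ≃ ℤ) (n : ℕ) :
    ∑' i, ENNReal.ofReal ((2 : ℝ) ^ (e i + 1)) ^ n * ν (dyadic (e i)) ≤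
      2 ^ n * ∫⁻ s, ENNReal.ofReal ((s : ℝ) ^ n) ∂ν := by
  rw [e.tsum_eq fun k => ENNReal.ofReal ((2 : ℝ) ^ (k + 1)) ^ n * ν (dyadic k),
    ← setLIntegral_univ (fun s : PosReal => ENNReal.ofReal ((s : ℝ) ^ n)), ← iUnion_dyadic,
    lintegral_iUnion measurableSet_dyadic pairwise_disjoint_dyadic, ← ENNReal.tsum_mul_left]
  refine ENNReal.tsum_le_tsum fun k => ?_
  rw [← lintegral_const_mul _ (by fun_prop), ← setLIntegral_const]
  refine setLIntegral_mono' (measurableSet_dyadic k) fun s hs => ?_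
  rw [ENNReal.ofReal_pow s.2.le, ← mul_pow]
  gcongr
  rw [← ENNReal.ofReal_ofNat, ← ENNReal.ofReal_mul zero_le_two, zpow_add_one₀ two_ne_zero, mul_comm]
  exact ENNReal.ofReal_le_ofReal (mul_le_mul_of_nonneg_left hs.1.le zero_le_two)

theorem lintegral_localMass_pow_lt_top (hπ : IsPoissonMeasure (ν.prod σ) π)
    (hν : HasFiniteMoments ν) {Λ : Set X} (hΛ : Λ ∈ BorelCompact X) (n : ℕ) :
    ∫⁻ γ, γ.localMass Λ ^ n ∂π < ∞ := by
  have := hπ.isProbabilityMeasure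
  let e : ℕ ≃ ℤ := Equiv.intEquivNat.symm
  have hB : ∀ i, dyadic (e i) ×ˢ Λ ∈ BorelCompact (PosReal × X) := fun i =>
    prod_mem_borelCompact (a := 2 ^ e i) (by positivity) (measurableSet_dyadic _)
      (fun s hs => Ioc_subset_Icc_self hs) hΛ
  refine lt_of_le_of_lt
    (lintegral_mono fun γ => pow_le_pow_left' (localMass_le_tsum_dyadic γ hΛ e) n) ?_
  refine lintegral_tsum_pow_lt_top (fun i => hπ.aemeasurable_count (hB i))
    (fun i => hπ.count_law _ (hB i))
    (fun k => hπ.count_indep k (fun i => dyadic (e i) ×ˢ Λ) (fun i => hB i) ?_) _ ?_ n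
  · intro i j hij
    refine Disjoint.set_prod_left (pairwise_disjoint_dyadic fun h => hij ?_) _ _
    exact Fin.ext (e.injective h)
  · intro n hn
    -- Each Poisson mean factors, so the sum `∑ aᵢ ^ n rᵢ` is `σ Λ` times the sum bounded in
    -- `tsum_dyadic_le`.
    have hlaw : ∀ i, (((ν.prod σ) (dyadic (e i) ×ˢ Λ)).toNNReal : ℝ≥0∞) =
        ν (dyadic (e i)) * σ Λ := fun i => by
      rw [ENNReal.coe_toNNReal (measure_lt_top_of_mem_borelCompact (hB i)).ne, Measure.prod_prod]
    simp only [hlaw, ← mul_assoc]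
    rw [ENNReal.tsum_mul_right]
    exact ENNReal.mul_lt_top ((tsum_dyadic_le ν e n).trans_lt
      (ENNReal.mul_lt_top (by simp) (hν n hn))) (measure_lt_top_of_mem_borelCompact hΛ)

end LocalMoments

/-! ### The intensity of the Gamma measure. -/

section Gamma

open scoped ENNReal

theorem lintegral_gammaIntensity (θ : ℝ) {f : ℝ → ℝ≥0∞} (hf : Measurable f) :
    ∫⁻ s, f (s : ℝ) ∂gammaIntensity θ =
      ∫⁻ s in Ioi (0 : ℝ), ENNReal.ofReal (θ / s * Real.exp (-s)) * f s := by
  rw [gammaIntensity, lintegral_withDensity_eq_lintegral_mul _ (by fun_prop) (by fun_prop),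
    ← lintegral_subtype_comap measurableSet_Ioi]
  rfl

theorem hasFiniteMoments_gammaIntensity {θ : ℝ} (hθ : 0 < θ) :
    HasFiniteMoments (gammaIntensity θ) := by
  intro n hn
  rw [lintegral_gammaIntensity θ (f := fun s => ENNReal.ofReal (s ^ n)) (by fun_prop)]
  have hn' : (0 : ℝ) < n := by exact_mod_cast hn
  -- The factor `1 / s` lowers `s ^ n` to `s ^ (n - 1)`, leaving `θ` times the integrand of `Γ(n)`,
  -- convergent because `n ≥ 1`.
  have hint := (Real.GammaIntegral_convergent hn').const_mul θ
  refine lt_of_eq_of_lt (setLIntegral_congr_fun measurableSet_Ioi fun s hs => ?_)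
    hint.lintegral_lt_top
  have hs0 : (0 : ℝ) < s := hs
  rw [← ENNReal.ofReal_mul (by positivity), Real.rpow_sub_one hs0.ne', Real.rpow_natCast]
  congr 1
  ring

instance (θ : ℝ) : NullSingletonClass (gammaIntensity θ) where
  measure_singleton s := by
    refine withDensity_absolutelyContinuous _ _ ?_
    rw [(MeasurableEmbedding.subtype_coe measurableSet_Ioi).comap_apply]
    simp

/-- The density is singular only at `0`: Markov's inequality with the finite first moment bounds the
mass of `(s / 2, ∞)`, a neighbourhood of `s`. -/
theorem isLocallyFiniteMeasure_gammaIntensity {θ : ℝ} (hθ : 0 < θ) :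
    IsLocallyFiniteMeasure (gammaIntensity θ) := by
  refine ⟨fun s => ⟨{t | (s : ℝ) / 2 < t}, ?_, ?_⟩⟩
  · exact (isOpen_lt continuous_const continuous_subtype_val).mem_nhds
      (half_lt_self (mem_Ioi.1 s.2))
  · have h1 := hasFiniteMoments_gammaIntensity hθ 1 le_rfl
    have hs : ENNReal.ofReal ((s : ℝ) / 2) ≠ 0 := by simpa using half_pos (mem_Ioi.1 s.2)
    refine (measure_mono fun t ht => ?_).trans_lt ((meas_ge_le_lintegral_div
      (f := fun t : PosReal => ENNReal.ofReal ((t : ℝ) ^ 1)) (by fun_prop) hs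
      ENNReal.ofReal_ne_top).trans_lt (ENNReal.div_lt_top h1.ne hs))
    exact ENNReal.ofReal_le_ofReal (by simpa using le_of_lt ht)

end Gamma

end Cone

/-! ### The equivalence and its application to the Gamma measure. -/

theorem mainTheorem10 {X : Type*} [TopologicalSpace X] [PolishSpace X] [LocallyCompactSpace X]
    [MeasurableSpace X] [BorelSpace X]
    (σ : Measure X) [IsLocallyFiniteMeasure σ] [NullSingletonClass σ] :
    (∀ (ν : Measure Cone.PosReal) [IsLocallyFiniteMeasure ν] [NullSingletonClass ν],
      ∫⁻ s, ENNReal.ofReal (s : ℝ) ∂ν < ⊤ → σ ≠ 0 →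
      ∀ μ : Measure (Cone.DiscreteMeasure X), Cone.IsConePoisson ν σ μ →
        (Cone.HasFiniteLocalMoments μ ↔ Cone.HasFiniteMoments ν)) ∧
    (∀ θ : ℝ, 0 < θ → ∀ μ : Measure (Cone.DiscreteMeasure X),
      Cone.IsConePoisson (Cone.gammaIntensity θ) σ μ → Cone.HasFiniteLocalMoments μ) := by
  -- This implication serves both halves; integrability of `s` is the case `n = 1` of the moment
  -- condition.
  have hif : ∀ (ν : Measure Cone.PosReal) [IsLocallyFiniteMeasure ν],
      ∀ μ : Measure (Cone.DiscreteMeasure X), Cone.IsConePoisson ν σ μ →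
        Cone.HasFiniteMoments ν → Cone.HasFiniteLocalMoments μ := by
    rintro ν _ μ ⟨π, hπ, rfl⟩ hmom
    have := hπ.isProbabilityMeasure
    have hae := Cone.ae_mem_pinpointingFinite hπ (by simpa using hmom 1 le_rfl)
    refine ⟨Cone.isProbabilityMeasure_coneLaw hae, fun n _ Λ hΛ => ?_⟩
    rw [Cone.lintegral_coneLaw hae hΛ.1]
    exact Cone.lintegral_localMass_pow_lt_top hπ hmom hΛ n
  refine ⟨fun ν _ _ hν hσ μ hμ => ⟨fun h n hn => ?_, hif ν μ hμ⟩, fun θ hθ μ hμ => ?_⟩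
  · obtain ⟨π, hπ, rfl⟩ := hμ
    have hae := Cone.ae_mem_pinpointingFinite hπ hν
    -- A nonzero `σ` charges some compact set, so the factor `σ Λ` in the lower bound can be
    -- cancelled.
    obtain ⟨k, hk⟩ : ∃ k, σ (compactCovering X k) ≠ 0 := by
      by_contra! h0
      refine hσ (Measure.measure_univ_eq_zero.1 ?_)
      rw [← iUnion_compactCovering X, measure_iUnion_null_iff]
      exact h0
    have hΛ : compactCovering X k ∈ Cone.BorelCompact X := Cone.mem_borelCompact_of_subset
      (isCompact_compactCovering X k).isClosed.measurableSet (isCompact_compactCovering X k)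
      subset_rfl
    have hle := (Cone.lintegral_pow_le_localMass_pow hπ hΛ.1 hn).trans_lt
      ((Cone.lintegral_coneLaw hae hΛ.1 n).symm.trans_lt (h.2 n hn _ hΛ))
    exact (ENNReal.lt_top_of_mul_ne_top_left hle.ne hk)
  · have := Cone.isLocallyFiniteMeasure_gammaIntensity hθ
    exact hif _ μ hμ (Cone.hasFiniteMoments_gammaIntensity hθ)
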